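/- A \emph{represented space} is a set $X$ with a partial surjection $\delta_X:\subseteq\mathbb N^{\mathbb N}\to X$; a \emph{name} of $x$ is any $p$ with $\delta_X(p)=x$. Baire space $\mathbb N^{\mathbb N}$ is represented by the identity, and products and countable powers in the usual way through the pairings $\langle p,q\rangle$ and $\langle p_0,p_1,\dots\rangle$. The space $\mathbf\Pi^0_1(\mathbb N^{\mathbb N})$ of closed subsets of Baire space is represented by letting the characteristic function of a tree $T\subseteq\mathbb N^{<\mathbb N}$ be a name of its set $[T]$ of infinite paths. For a partial multivalued function $f:\subseteq X\rightrightarrows Y$ between represented spaces, $\operatorname{dom}(f)=\{x: f(x)\neq\emptyset\}$, and a partial function $F:\subseteq\mathbb N^{\mathbb N}\to\mathbb N^{\mathbb N}$ is a \emph{realizer} of $f$ if $F(p)$ is defined and is a name of an element of $f(x)$ whenever $p$ is a name of some $x\in\operatorname{dom}(f)$. Write $f\le_{\mathrm W}g$ ($f$ is \emph{Weihrauch reducible} to $g$) if there are computable $\Phi,\Psi:\subseteq\mathbb N^{\mathbb N}\to\mathbb N^{\mathbb N}$ such that, for every realizer $G$ of $g$, the function $p\mapsto\Psi(\langle p,G(\Phi(p))\rangle)$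 is a realizer of $f$. Let $\mathsf{lim}:\subseteq(\mathbb N^{\mathbb N})^{\mathbb N}\to\mathbb N^{\mathbb N}$ map each convergent sequence to its limit. The jump $X'$ of a represented space $X$ is the same set, where $\langle p_0,p_1,\dots\rangle$ is a name of $x$ iff $\lim_n p_n$ exists and is a name of $x$ in $X$; the jump of $f:\subseteq X\rightrightarrows Y$ is $f$ regarded as a multivalued function $\subseteq X'\rightrightarrows Y$, and $\mathsf{lim}^{(n)}$ is the $n$-fold jump of $\mathsf{lim}$. A partial function $F:\subseteq\mathbb N^{\mathbb N}\to\mathbb N^{\mathbb N}$ is \emph{arithmetic} if $F\le_{\mathrm W}\mathsf{lim}^{(n)}$ for some $n\in\mathbb N$. Write $f\le^a_{\mathrm W}g$ ($f$ is \emph{arithmetically Weihrauch reducible} to $g$) if the definition of $f\le_{\mathrm W}g$ holds with arithmetic instead of computable $\Phi,\Psi$. Let $\mathsf{TC}_{\mathbb N^{\mathbb N}}:\mathbf\Pi^0_1(\mathbb N^{\mathbb N})\rightrightarrows\mathbb N^{\mathbb N}$ be given by $\mathsf{TC}_{\mathbb N^{\mathbb N}}(A)=A$ if $A\ne\emptyset$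 and $\mathsf{TC}_{\mathbb N^{\mathbb N}}(\emptyset)=\mathbb N^{\mathbb N}$, and let $\mathsf{sTC}_{\mathbb N^{\mathbb N}}:\mathbf\Pi^0_1(\mathbb N^{\mathbb N})\rightrightarrows\{0,1\}\times\mathbb N^{\mathbb N}$ be given by \[\mathsf{sTC}_{\mathbb N^{\mathbb N}}(A)=\{(b,x): (b=0\to A=\emptyset)\wedge(b=1\to x\in A)\}.\] The parallel product is $(f\times g)(x,z)=f(x)\times g(z)$. \textbf{Theorem.} For every partial multivalued function $f$ between represented spaces, \[ f\le^a_{\mathrm W}\mathsf{TC}_{\mathbb N^{\mathbb N}}\iff(\exists n\in\mathbb N)\ \bigl(f\le_{\mathrm W}\mathsf{sTC}_{\mathbb N^{\mathbb N}}\times\mathsf{lim}^{(n)}\bigr).\] -/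

import Mathlib

open Filter Topology

/-! ### Baire space and type-two computability -/

namespace Weihrauch

/-- Baire space, with the product topology of the discrete topologies. -/
abbrev Baire : Type := ℕ → ℕ

/-- The prefix of length `n` of `p`. -/
def prefixOf (p : Baire) (n : ℕ) : List ℕ := (List.range n).map p

/-- The join `⟨p, q⟩`, with `⟨p, q⟩ (2 n) = p n` and `⟨p, q⟩ (2 n + 1) = q n`. -/
def join (p q : Baire) : Baire := fun n => if n % 2 = 0 then p (n / 2) else q (n / 2)

/-- First component of `r = ⟨p, q⟩`. -/
def evenPart (r : Baire) : Baire := fun n => r (2 * n)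

/-- Second component of `r = ⟨p, q⟩`. -/
def oddPart (r : Baire) : Baire := fun n => r (2 * n + 1)

/-- The `i`-th component `pᵢ` of `p = ⟨p₀, p₁, …⟩`, where `⟨p₀, p₁, …⟩ (⟨i, j⟩) = pᵢ j`. -/
def row (p : Baire) (i : ℕ) : Baire := fun j => p (Nat.pair i j)

/-- A partial function on Baire space is computable if a type-two machine computes it on its
domain: there is a computable, prefix-monotone `h` (the output written after inspecting a finite
part of the input) such that, for `p` in the domain, the words `h (p[n])` exhaust the value at
`p`. (By monotonicity each `h (p[n])` is then itself a prefix of that value.) -/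
def IsComputable (F : Baire →. Baire) : Prop :=
  ∃ h : List ℕ → List ℕ, Computable h ∧ (∀ σ τ, σ <+: τ → h σ <+: h τ) ∧
    ∀ p, ∀ q ∈ F p, ∀ k, ∃ n, prefixOf q k <+: h (prefixOf p n)

/-! ### Represented spaces -/

/-- A representation of `X`: a partial surjection from Baire space onto `X`, given by its graph.
`IsName p x` says that `p` is a name of `x`. -/
structure Representation (X : Type*) where
  IsName : Baire → X → Prop
  unique : ∀ {p x y}, IsName p x → IsName p y → x = y
  surj : ∀ x, ∃ p, IsName p x

theorem evenPart_join (p q : Baire) : evenPart (join p q) = p := by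
  funext n
  simp [evenPart, join]

theorem oddPart_join (p q : Baire) : oddPart (join p q) = q := by
  funext n
  have h1 : (2 * n + 1) % 2 = 1 := by omega
  have h2 : (2 * n + 1) / 2 = n := by omega
  simp [oddPart, join, h1, h2]

namespace Representation

/-- Baire space, represented by the identity. -/
def baire : Representation Baire where
  IsName p x := p = x
  unique h h' := h.symm.trans h'
  surj x := ⟨x, rfl⟩

/-- The two-point space; `p` is a name of `p 0`. -/
def two : Representation (Fin 2) where
  IsName p b := p 0 = (b : ℕ)
  unique h h' := Fin.ext (h.symm.trans h')
  surj b := ⟨fun _ => b, rfl⟩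

/-- Product: the names of `(x, y)` are the `⟨p, q⟩` with `p` a name of `x` and `q` of `y`. -/
def prod {X Y : Type*} (dX : Representation X) (dY : Representation Y) :
    Representation (X × Y) where
  IsName r z := dX.IsName (evenPart r) z.1 ∧ dY.IsName (oddPart r) z.2
  unique h h' := Prod.ext (dX.unique h.1 h'.1) (dY.unique h.2 h'.2)
  surj z := by
    obtain ⟨p, hp⟩ := dX.surj z.1
    obtain ⟨q, hq⟩ := dY.surj z.2
    exact ⟨join p q, by rwa [evenPart_join], by rwa [oddPart_join]⟩

/-- Countable power: `⟨p₀, p₁, …⟩` is a name of a sequence if each `pᵢ` is a name of its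
`i`-th term. -/
def seq {X : Type*} (dX : Representation X) : Representation (ℕ → X) where
  IsName r z := ∀ i, dX.IsName (row r i) (z i)
  unique h h' := funext fun i => dX.unique (h i) (h' i)
  surj z := by
    choose p hp using fun i => dX.surj (z i)
    refine ⟨fun n => p n.unpair.1 n.unpair.2, fun i => ?_⟩
    have h : row (fun n => p n.unpair.1 n.unpair.2) i = p i := by
      funext j
      simp [row]
    rw [h]
    exact hp i

/-- Jump: `⟨p₀, p₁, …⟩` is a name of `x` if `lim pₙ` exists and is a name of `x` in the original
sense. -/
def jump {X : Type*} (dX : Representation X) : Representation X where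
  IsName p x := ∃ q : Baire, Tendsto (row p) atTop (𝓝 q) ∧ dX.IsName q x
  unique := by
    rintro p x y ⟨q, hq, hx⟩ ⟨r, hr, hy⟩
    obtain rfl := tendsto_nhds_unique hq hr
    exact dX.unique hx hy
  surj x := by
    obtain ⟨q, hq⟩ := dX.surj x
    refine ⟨fun n => q n.unpair.2, q, ?_, hq⟩
    have h : row (fun n => q n.unpair.2) = fun _ => q := by
      funext i j
      simp [row]
    rw [h]
    exact tendsto_const_nhds

end Representation

/-! ### Trees and closed subsets of Baire space -/

/-- A tree on `ℕ`: a set of finite sequences closed under prefixes. -/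
def IsTree (T : Set (List ℕ)) : Prop := ∀ σ τ, σ <+: τ → τ ∈ T → σ ∈ T

/-- The set `[T]` of infinite paths through `T`. -/
def paths (T : Set (List ℕ)) : Set Baire := {p | ∀ n, prefixOf p n ∈ T}

/-- `p` is the characteristic function of `T` (finite sequences being coded by numbers). -/
def IsCharFun (p : Baire) (T : Set (List ℕ)) : Prop :=
  ∀ σ, (σ ∈ T ∧ p (Encodable.encode σ) = 1) ∨ (σ ∉ T ∧ p (Encodable.encode σ) = 0)

theorem isCharFun_unique {p : Baire} {S T : Set (List ℕ)} (hS : IsCharFun p S)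
    (hT : IsCharFun p T) : S = T := by
  ext σ
  rcases hS σ with h | h <;> rcases hT σ with h' | h' <;> simp_all

theorem exists_isCharFun (T : Set (List ℕ)) : ∃ p, IsCharFun p T := by
  classical
  refine ⟨fun n => if ∃ σ ∈ T, Encodable.encode σ = n then 1 else 0, fun σ => ?_⟩
  by_cases h : σ ∈ T
  · exact Or.inl ⟨h, if_pos ⟨σ, h, rfl⟩⟩
  · refine Or.inr ⟨h, if_neg ?_⟩
    rintro ⟨τ, hτ, e⟩
    exact h (Encodable.encode_injective e ▸ hτ)

theorem prefixOf_eq_iff {p q : Baire} {n : ℕ} :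
    prefixOf p n = prefixOf q n ↔ ∀ i < n, p i = q i := by
  simp [prefixOf]

theorem exists_tree_paths_eq {A : Set Baire} (hA : IsClosed A) :
    ∃ T, IsTree T ∧ paths T = A := by
  refine ⟨{σ | ∃ p ∈ A, ∃ n, σ = prefixOf p n}, ?_, ?_⟩
  · rintro σ τ hστ ⟨p, hp, n, rfl⟩
    refine ⟨p, hp, min σ.length n, ?_⟩
    have h := List.prefix_iff_eq_take.1 hστ
    rw [h]
    simp [prefixOf, ← List.map_take, List.take_range]
  · ext p
    refine ⟨fun h => ?_, fun h n => ⟨p, h, n, rfl⟩⟩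
    choose q hq m hm using h
    have hlen : ∀ n, m n = n := fun n => by
      have := congrArg List.length (hm n)
      simpa [prefixOf] using this.symm
    refine hA.mem_of_tendsto (f := q) (b := atTop) ?_ (Eventually.of_forall hq)
    refine tendsto_pi_nhds.2 fun i => tendsto_const_nhds.congr' ?_
    filter_upwards [eventually_gt_atTop i] with n hn
    have h := hm n
    rw [hlen n] at h
    exact prefixOf_eq_iff.1 h i hn

/-- The space of closed subsets of Baire space: the names of `A` are the characteristic functions
of the trees `T` with `[T] = A`. -/
def Representation.closeds : Representation (TopologicalSpace.Closeds Baire) where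
  IsName p A := ∃ T, IsTree T ∧ IsCharFun p T ∧ paths T = (A : Set Baire)
  unique := by
    rintro p A B ⟨S, -, hS, hA⟩ ⟨T, -, hT, hB⟩
    obtain rfl := isCharFun_unique hS hT
    exact TopologicalSpace.Closeds.ext (hA.symm.trans hB)
  surj A := by
    obtain ⟨T, hT, h⟩ := exists_tree_paths_eq A.isClosed
    obtain ⟨p, hp⟩ := exists_isCharFun T
    exact ⟨p, T, hT, hp, h⟩

/-! ### Multivalued functions and reducibilities -/

/-- A partial multivalued function between the represented spaces `(X, domRep)` and
`(Y, codRep)`; its domain is the set of `x` for which `val x` is nonempty. -/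
structure MultiFun (X Y : Type*) where
  domRep : Representation X
  codRep : Representation Y
  val : X → Set Y

/-- `F` is a realizer of `f`: it maps every name of an `x` in the domain of `f` to a name of an
element of `f x`. -/
def Realizes {X Y : Type*} (F : Baire →. Baire) (f : MultiFun X Y) : Prop :=
  ∀ p x, f.domRep.IsName p x → (f.val x).Nonempty →
    ∃ q ∈ F p, ∃ y ∈ f.val x, f.codRep.IsName q y

/-- The partial function `p ↦ Ψ ⟨p, G (Φ p)⟩`. -/
def reduct (Φ Ψ G : Baire →. Baire) : Baire →. Baire :=
  fun p => (Φ p).bind fun r => (G r).bind fun s => Ψ (join p s)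

/-- Weihrauch reducibility. -/
def WeihrauchLE {X Y Z W : Type*} (f : MultiFun X Y) (g : MultiFun Z W) : Prop :=
  ∃ Φ Ψ : Baire →. Baire, IsComputable Φ ∧ IsComputable Ψ ∧
    ∀ G, Realizes G g → Realizes (reduct Φ Ψ G) f

namespace MultiFun

/-- A partial function on Baire space as a multivalued function. -/
def ofPFun (F : Baire →. Baire) : MultiFun Baire Baire where
  domRep := .baire
  codRep := .baire
  val p := {q | q ∈ F p}

/-- Parallel product. -/
def prod {X Y Z W : Type*} (f : MultiFun X Y) (g : MultiFun Z W) : MultiFun (X × Z) (Y × W) where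
  domRep := f.domRep.prod g.domRep
  codRep := f.codRep.prod g.codRep
  val x := f.val x.1 ×ˢ g.val x.2

/-- Jump of a multivalued function. -/
def jump {X Y : Type*} (f : MultiFun X Y) : MultiFun X Y where
  domRep := f.domRep.jump
  codRep := f.codRep
  val := f.val

/-- Total continuation: arbitrary values outside the domain. -/
def totalization {X Y : Type*} (f : MultiFun X Y) : MultiFun X Y where
  domRep := f.domRep
  codRep := f.codRep
  val x := {y | (f.val x).Nonempty → y ∈ f.val x}

/-- `lim`, mapping a convergent sequence in Baire space to its limit. -/
def lim : MultiFun (ℕ → Baire) Baire where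
  domRep := Representation.baire.seq
  codRep := .baire
  val p := {q | Tendsto p atTop (𝓝 q)}

/-- `lim⁽ⁿ⁾`, the `n`-th jump of `lim`. -/
def limJump : ℕ → MultiFun (ℕ → Baire) Baire
  | 0 => lim
  | n + 1 => (limJump n).jump

/-- Closed choice on Baire space: find an element of a nonempty closed set. -/
def closedChoice : MultiFun (TopologicalSpace.Closeds Baire) Baire where
  domRep := .closeds
  codRep := .baire
  val A := (A : Set Baire)

/-- `TC`, the total continuation of closed choice on Baire space. -/
def TC : MultiFun (TopologicalSpace.Closeds Baire) Baire := closedChoice.totalization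

/-- `sTC`, the strong total continuation of closed choice on Baire space. -/
def sTC : MultiFun (TopologicalSpace.Closeds Baire) (Fin 2 × Baire) where
  domRep := .closeds
  codRep := Representation.two.prod .baire
  val A := {z | (z.1 = 0 → (A : Set Baire) = ∅) ∧ (z.1 = 1 → z.2 ∈ (A : Set Baire))}

end MultiFun

/-- A partial function on Baire space is arithmetic if it is Weihrauch reducible to some
`lim⁽ⁿ⁾`. -/
def IsArithmetic (F : Baire →. Baire) : Prop :=
  ∃ n, WeihrauchLE (MultiFun.ofPFun F) (MultiFun.limJump n)

/-- Arithmetic Weihrauch reducibility. -/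
def ArithWeihrauchLE {X Y Z W : Type*} (f : MultiFun X Y) (g : MultiFun Z W) : Prop :=
  ∃ Φ Ψ : Baire →. Baire, IsArithmetic Φ ∧ IsArithmetic Ψ ∧
    ∀ G, Realizes G g → Realizes (reduct Φ Ψ G) f

end Weihrauch

/-!
The proof replaces arithmetic partial functionals by total ones in a normal form. Call a total
functional on Baire space limit computable (`LimComputable`) if it is a fixed finite number of
iterated limits of a functional whose use of the oracle is computably bounded (`BoundedUse`), these
limits existing at every oracle. Such functionals are closed under composition and pairing, because
functionals with bounded use are continuous and can be pulled inside limits (`IterLim.mapRows`).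
Every computable partial functional has a limit computable total extension
(`IsComputable.exists_limComputable`), and so does the limit itself (`exists_limComputable_lim`).
As `lim⁽ⁿ⁾` is the `(n + 1)`-fold iterated limit, the arithmetic functionals are therefore exactly
the restrictions of the limit computable ones (`IsArithmetic.exists_limComputable`,
`LimComputable.isArithmetic`).

If `f` reduces to `sTC × lim⁽ⁿ⁾`, then an answer `a` of `TC` for a closed set `A` is turned into an
answer of `sTC` by deciding whether `a ∈ A`, which is arithmetic; if `a ∉ A` then `A = ∅`. The
value of `lim⁽ⁿ⁾` is arithmetic as well.

Conversely, let `f` reduce to `TC` by arithmetic `Φ` and `Ψ`, extended to total limit computable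
functionals. An iterated limit is certified by its intermediate limits and their moduli of
convergence, a closed condition (`exists_iterLim_witness`). So from `p` one computes a name of the
closed set of all `x` in the set named by `Φ p` together with the value `Ψ ⟨p, x⟩` and a certificate
for both (`exists_tree_of_limComputable`), and an element of this set, if there is one, contains the
result. If `sTC` says that it is empty, then `Φ p` names the empty set, every point is a correct
answer of `TC`, and the result is `Ψ ⟨p, 0⟩`, which `lim⁽ⁿ⁾` has computed in parallel; the totality
of the extension of `Ψ` makes this instance of `lim⁽ⁿ⁾` valid in all cases.
-/

namespace Weihrauch

/-! ### Prefixes and joins -/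

theorem length_prefixOf (p : Baire) (n : ℕ) : (prefixOf p n).length = n := by
  simp [prefixOf]

theorem prefixOf_getD (σ : List ℕ) : prefixOf (fun i => σ.getD i 0) σ.length = σ := by
  refine List.ext_getElem (length_prefixOf _ _) fun i h1 h2 => ?_
  simp [prefixOf, h2]

theorem take_prefixOf (p : Baire) {m n : ℕ} (h : m ≤ n) : (prefixOf p n).take m = prefixOf p m := by
  simp [prefixOf, ← List.map_take, List.take_range, h]

theorem prefixOf_isPrefix (p : Baire) {m n : ℕ} (h : m ≤ n) : prefixOf p m <+: prefixOf p n :=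
  take_prefixOf p h ▸ List.take_prefix _ _

theorem prefixOf_getD_of_isPrefix {σ τ : List ℕ} (h : σ <+: τ) :
    prefixOf (fun i => τ.getD i 0) σ.length = σ := by
  rw [← take_prefixOf _ h.length_le, prefixOf_getD]
  exact (List.prefix_iff_eq_take.1 h).symm

theorem getD_prefixOf (p : Baire) {i n : ℕ} (h : i < n) : (prefixOf p n).getD i 0 = p i := by
  simp [prefixOf, h]

theorem join_evenPart_oddPart (r : Baire) : join (evenPart r) (oddPart r) = r := by
  funext n
  rcases Nat.mod_two_eq_zero_or_one n with h | h
  · simp only [join, h, if_true, evenPart]; congr 1; omega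
  · simp only [join, h, oddPart]; simp; congr 1; omega

theorem join_eq_zero {p q : Baire} : join p q = 0 ↔ p = 0 ∧ q = 0 := by
  constructor
  · intro h
    exact ⟨(evenPart_join p q).symm.trans (by rw [h]; rfl),
      (oddPart_join p q).symm.trans (by rw [h]; rfl)⟩
  · rintro ⟨rfl, rfl⟩
    funext n
    simp [join]

/-! ### Functionals with computably bounded use -/

section BoundedUse

variable {α β γ δ : Type*} [Primcodable α] [Primcodable β] [Primcodable γ] [Primcodable δ]

theorem computable_map_range {f : α × ℕ → β} {g : α → ℕ} (hf : Computable f) (hg : Computable g) :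
    Computable fun a => (List.range (g a)).map fun j => f (a, j) := by
  have h := Computable.nat_rec (f := g) (g := fun _ : α => ([] : List β))
    (h := fun a y => y.2 ++ [f (a, y.1)]) hg (Computable.const _)
    (Computable.list_concat.comp (Computable.snd.comp Computable.snd)
      (hf.comp (Computable.pair Computable.fst (Computable.fst.comp Computable.snd))))
  refine h.of_eq fun a => ?_
  induction g a with
  | zero => rfl
  | succ n ih => simp [ih, List.range_succ]

theorem computable_two_mul : Computable fun n : ℕ => 2 * n :=
  (Primrec.nat_mul.comp (Primrec.const 2) Primrec.id).to_comp

theorem computable_two_mul_add_one : Computable fun n : ℕ => 2 * n + 1 :=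
  Computable.succ.comp computable_two_mul

theorem computable_div_two : Computable fun n : ℕ => n / 2 :=
  (Primrec.nat_div.comp Primrec.id (Primrec.const 2)).to_comp

theorem computable_mod_two : Computable fun n : ℕ => n % 2 :=
  (Primrec.nat_mod.comp Primrec.id (Primrec.const 2)).to_comp

theorem computable_unpair_fst : Computable fun n : ℕ => n.unpair.1 :=
  Computable.fst.comp Computable.unpair

theorem computable_unpair_snd : Computable fun n : ℕ => n.unpair.2 :=
  Computable.snd.comp Computable.unpair

theorem computable_pair : Computable₂ Nat.pair := Primrec₂.natPair.to_comp

/-- `F p a` is computed from `a` and any prefix of the oracle `p` whose length is at least a bound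
computable from `a` alone (truth-table style computability, for total functionals). Any longer
prefix must give the same value, so that two functionals can be evaluated on a common prefix. A
functional `Baire → Baire` is the case `α = β = ℕ`. -/
def BoundedUse (F : Baire → α → β) : Prop :=
  ∃ (b : α → ℕ) (c : List ℕ × α → β), Computable b ∧ Computable c ∧
    ∀ p a n, b a ≤ n → F p a = c (prefixOf p n, a)

namespace BoundedUse

/-- A computable function that ignores the oracle. -/
theorem of_computable {f : α → β} (hf : Computable f) : BoundedUse fun _ a => f a :=
  ⟨fun _ => 0, fun x => f x.2, Computable.const _, hf.comp Computable.snd, fun _ _ _ _ => rfl⟩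

protected theorem const (c : β) : BoundedUse fun (_ : Baire) (_ : α) => c :=
  of_computable (Computable.const c)

/-- Querying the oracle at a position that does not depend on the oracle. -/
protected theorem apply {g : α → ℕ} (hg : Computable g) : BoundedUse fun p a => p (g a) :=
  ⟨fun a => g a + 1, fun x => x.1.getD (g x.2) 0, Computable.succ.comp hg,
    (Primrec.list_getD 0).to_comp.comp Computable.fst (hg.comp Computable.snd),
    fun p _ _ h => (getD_prefixOf p h).symm⟩

protected theorem map {F : Baire → α → β} (hF : BoundedUse F) {f : β → γ} (hf : Computable f) :
    BoundedUse fun p a => f (F p a) := by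
  obtain ⟨b, c, hb, hc, h⟩ := hF
  exact ⟨b, fun x => f (c x), hb, hf.comp hc, fun p a n hn => congrArg f (h p a n hn)⟩

protected theorem pair {F : Baire → α → β} {G : Baire → α → γ} (hF : BoundedUse F)
    (hG : BoundedUse G) : BoundedUse fun p a => (F p a, G p a) := by
  obtain ⟨b, c, hb, hc, h⟩ := hF
  obtain ⟨b', c', hb', hc', h'⟩ := hG
  refine ⟨fun a => max (b a) (b' a), fun x => (c x, c' x), Primrec.nat_max.to_comp.comp hb hb',
    hc.pair hc', fun p a n hn => ?_⟩
  exact Prod.ext (h p a n (le_of_max_le_left hn)) (h' p a n (le_of_max_le_right hn))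

protected theorem map₂ {F : Baire → α → β} {G : Baire → α → γ} (hF : BoundedUse F)
    (hG : BoundedUse G) {f : β → γ → δ} (hf : Computable₂ f) :
    BoundedUse fun p a => f (F p a) (G p a) :=
  (hF.pair hG).map hf

theorem reindex {F : Baire → α → β} (hF : BoundedUse F) {g : γ → α} (hg : Computable g) :
    BoundedUse fun p a => F p (g a) := by
  obtain ⟨b, c, hb, hc, h⟩ := hF
  exact ⟨fun a => b (g a), fun x => c (x.1, g x.2), hb.comp hg,
    hc.comp (Computable.fst.pair (hg.comp Computable.snd)), fun p a n hn => h p (g a) n hn⟩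

protected theorem ite_eq {F G : Baire → α → β} [DecidableEq β] {U V : Baire → α → γ}
    (hF : BoundedUse F) (hG : BoundedUse G) (hU : BoundedUse U) (hV : BoundedUse V) :
    BoundedUse fun p a => if F p a = G p a then U p a else V p a := by
  have hd : Computable fun x : (β × β) × (γ × γ) =>
      bif decide (x.1.1 = x.1.2) then x.2.1 else x.2.2 :=
    Computable.cond ((Primrec.eq (α := β)).decide.to_comp.comp
        (Computable.fst.comp Computable.fst) (Computable.snd.comp Computable.fst))
      (Computable.fst.comp Computable.snd) (Computable.snd.comp Computable.snd)
  convert ((hF.pair hG).pair (hU.pair hV)).map hd using 3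
  simp [Bool.cond_decide]

protected theorem prefixOf {F : Baire → α × ℕ → ℕ} (hF : BoundedUse F) {g : α → ℕ}
    (hg : Computable g) : BoundedUse fun p a => prefixOf (fun j => F p (a, j)) (g a) := by
  obtain ⟨b, c, hb, hc, h⟩ := hF
  refine ⟨fun a => Nat.rec 0 (fun j m => max m (b (a, j))) (g a),
    fun x => (List.range (g x.2)).map fun j => c (x.1, (x.2, j)), ?_, ?_, fun p a n hn => ?_⟩
  · exact Computable.nat_rec (h := fun a y => max y.2 (b (a, y.1))) hg (Computable.const _)
      (Primrec.nat_max.to_comp.comp (Computable.snd.comp Computable.snd)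
      (hb.comp (Computable.pair Computable.fst (Computable.fst.comp Computable.snd))))
  · exact computable_map_range (f := fun y : (List ℕ × α) × ℕ => c (y.1.1, (y.1.2, y.2)))
      (hc.comp ((Computable.fst.comp Computable.fst).pair
        ((Computable.snd.comp Computable.fst).pair Computable.snd))) (hg.comp Computable.snd)
  · refine List.map_congr_left fun j hj => h p (a, j) n (le_trans ?_ hn)
    have key : ∀ N, j < N → b (a, j) ≤ Nat.rec 0 (fun j m => max m (b (a, j))) N := by
      intro N hN
      induction N with
      | zero => omega
      | succ N ih =>
        rcases Nat.lt_succ_iff_lt_or_eq.1 hN with h | rfl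
        · exact le_max_of_le_left (ih h)
        · exact le_max_right _ _
    exact key _ (List.mem_range.1 hj)

/-- Replacing the oracle of `F` by one computed from `p` and a parameter `a`. -/
protected theorem subst {F : Baire → α → β} (hF : BoundedUse F) {Θ : Baire → γ × ℕ → ℕ}
    (hΘ : BoundedUse Θ) {g : γ → α} (hg : Computable g) :
    BoundedUse fun p a => F (fun j => Θ p (a, j)) (g a) := by
  obtain ⟨b, c, hb, hc, h⟩ := hF
  simp only [fun p a => h p a _ le_rfl]
  exact ((hΘ.prefixOf (hb.comp hg)).pair (of_computable hg)).map hc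

protected theorem comp {F : Baire → α → β} (hF : BoundedUse F) {Θ : Baire → Baire}
    (hΘ : BoundedUse Θ) : BoundedUse fun p => F (Θ p) :=
  hF.subst (hΘ.reindex (γ := α × ℕ) Computable.snd) Computable.id

protected theorem id : BoundedUse fun p : Baire => p := BoundedUse.apply Computable.id

protected theorem even {Θ : Baire → Baire} (hΘ : BoundedUse Θ) :
    BoundedUse fun p => evenPart (Θ p) :=
  hΘ.reindex computable_two_mul

protected theorem odd {Θ : Baire → Baire} (hΘ : BoundedUse Θ) :
    BoundedUse fun p => oddPart (Θ p) :=
  hΘ.reindex computable_two_mul_add_one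

protected theorem join {Θ Ξ : Baire → Baire} (hΘ : BoundedUse Θ) (hΞ : BoundedUse Ξ) :
    BoundedUse fun p => join (Θ p) (Ξ p) :=
  BoundedUse.ite_eq (of_computable computable_mod_two) (BoundedUse.const 0)
    (hΘ.reindex computable_div_two) (hΞ.reindex computable_div_two)

theorem exists_eq_of_prefixOf_eq {F : Baire → α → β} (hF : BoundedUse F) :
    ∃ b : α → ℕ, Computable b ∧
      ∀ p q a, prefixOf p (b a) = prefixOf q (b a) → F p a = F q a := by
  obtain ⟨b, c, hb, hc, h⟩ := hF
  exact ⟨b, hb, fun p q a e => by rw [h p a _ le_rfl, h q a _ le_rfl, e]⟩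

end BoundedUse

/-- The greedy count, after `i` rounds, of initial positions `j` whose bound `b j` is at most `n`:
with `i = n`, the number of output symbols a machine with use bound `b` writes after reading `n`
symbols of the input. -/
def outputLength (b : ℕ → ℕ) (n i : ℕ) : ℕ :=
  Nat.rec 0 (fun _ K => if b K ≤ n then K + 1 else K) i

theorem outputLength_mono (b : ℕ → ℕ) {m n i j : ℕ} (hmn : m ≤ n) (hij : i ≤ j) :
    outputLength b m i ≤ outputLength b n j := by
  have h1 : outputLength b n i ≤ outputLength b n j := by
    induction hij with
    | refl => exact le_rfl
    | step _ ih =>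
      refine ih.trans ?_
      simp only [outputLength]
      split_ifs <;> omega
  refine le_trans ?_ h1
  clear h1 hij
  induction i with
  | zero => exact le_rfl
  | succ i ih =>
    simp only [outputLength] at ih ⊢
    rcases ih.lt_or_eq with h | h
    · split_ifs <;> omega
    · rw [h]
      split_ifs <;> omega

theorem le_of_lt_outputLength {b : ℕ → ℕ} {n i j : ℕ} (h : j < outputLength b n i) : b j ≤ n := by
  induction i with
  | zero => exact absurd h (Nat.not_lt_zero _)
  | succ i ih =>
    simp only [outputLength] at ih h
    split_ifs at h with h'
    · rcases Nat.lt_succ_iff_lt_or_eq.1 h with h | rfl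
      exacts [ih h, h']
    · exact ih h

theorem exists_le_outputLength (b : ℕ → ℕ) (k : ℕ) : ∃ n, k ≤ outputLength b n n := by
  obtain ⟨N, hN⟩ : ∃ N, ∀ j < k, b j ≤ N :=
    ⟨(Finset.range k).sup b, fun j hj => Finset.le_sup (f := b) (Finset.mem_range.2 hj)⟩
  refine ⟨max N k, le_trans (le_of_eq ?_) (outputLength_mono b le_rfl (le_max_right N k))⟩
  have : ∀ i ≤ k, i = outputLength b (max N k) i := by
    intro i hi
    induction i with
    | zero => rfl
    | succ i ih =>
      have e := ih (by omega)
      simp only [outputLength] at e ⊢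
      rw [← e, if_pos (le_max_of_le_left (hN i hi))]
  exact this k le_rfl

/-- On input `σ` the machine writes the values whose use is covered by `σ`, up to the first one
that is not. -/
theorem BoundedUse.isComputable {Φ : Baire → Baire} (hΦ : BoundedUse Φ) :
    IsComputable fun p => Part.some (Φ p) := by
  obtain ⟨b, c, hb, hc, h⟩ := hΦ
  have hK : Computable fun σ : List ℕ => outputLength b σ.length σ.length := by
    have := Computable.nat_rec (f := fun σ : List ℕ => σ.length) (g := fun _ => 0)
      (h := fun σ y => bif decide (b y.2 ≤ σ.length) then y.2 + 1 else y.2)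
      Computable.list_length (Computable.const _)
      (Computable.cond (Primrec.nat_le.decide.to_comp.comp
          (hb.comp (Computable.snd.comp Computable.snd))
          (Computable.list_length.comp Computable.fst))
        (Computable.succ.comp (Computable.snd.comp Computable.snd))
        (Computable.snd.comp Computable.snd))
    refine this.of_eq fun σ => ?_
    simp only [outputLength, Bool.cond_decide]
  -- the word written on `σ` is a prefix of `Φ p` for every `p` extending `σ`
  have key : ∀ p σ, prefixOf p σ.length = σ →
      (List.range (outputLength b σ.length σ.length)).map (fun j => c (σ, j)) =
        prefixOf (Φ p) (outputLength b σ.length σ.length) := by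
    intro p σ hp
    refine List.map_congr_left fun j hj => ?_
    rw [h p j _ (le_of_lt_outputLength (List.mem_range.1 hj)), hp]
  refine ⟨_, computable_map_range hc hK, fun σ τ hστ => ?_, fun p q hq k => ?_⟩
  · rw [key _ σ (prefixOf_getD_of_isPrefix hστ), key _ τ (prefixOf_getD τ)]
    exact prefixOf_isPrefix _ (outputLength_mono b hστ.length_le hστ.length_le)
  · obtain rfl := Part.mem_some_iff.1 hq
    obtain ⟨n, hn⟩ := exists_le_outputLength b k
    refine ⟨n, ?_⟩
    rw [key p _ (by rw [length_prefixOf]), length_prefixOf]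
    exact prefixOf_isPrefix _ hn

end BoundedUse

/-! ### Limits of rows -/

theorem tendsto_baire_iff {u : ℕ → Baire} {q : Baire} :
    Tendsto u atTop (𝓝 q) ↔ ∀ k, ∀ᶠ n in atTop, u n k = q k := by
  simp only [tendsto_pi_nhds, nhds_discrete, tendsto_pure]

theorem tendsto_row_iff {p q : Baire} :
    Tendsto (row p) atTop (𝓝 q) ↔ ∀ k, ∃ N, ∀ n, N ≤ n → p (Nat.pair n k) = q k := by
  simp only [tendsto_baire_iff, eventually_atTop, row]

theorem exists_tendsto_row {p : Baire}
    (h : ∀ k, ∃ v N, ∀ n, N ≤ n → p (Nat.pair n k) = v) : ∃ q, Tendsto (row p) atTop (𝓝 q) := by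
  choose q hq using h
  exact ⟨q, tendsto_row_iff.2 hq⟩

theorem eventually_prefixOf_eq {u : ℕ → Baire} {q : Baire} (h : Tendsto u atTop (𝓝 q)) (k : ℕ) :
    ∀ᶠ n in atTop, prefixOf (u n) k = prefixOf q k := by
  rw [tendsto_baire_iff] at h
  filter_upwards [(eventually_all_finset (Finset.range k)).2 fun i _ => h i] with n hn
  exact prefixOf_eq_iff.2 fun i hi => hn i (Finset.mem_range.2 hi)

theorem BoundedUse.tendsto {Φ : Baire → Baire} (hΦ : BoundedUse Φ) {u : ℕ → Baire} {q : Baire}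
    (h : Tendsto u atTop (𝓝 q)) : Tendsto (fun n => Φ (u n)) atTop (𝓝 (Φ q)) := by
  obtain ⟨b, -, hb⟩ := hΦ.exists_eq_of_prefixOf_eq
  rw [tendsto_baire_iff]
  intro k
  filter_upwards [eventually_prefixOf_eq h (b k)] with n hn
  exact hb _ _ _ hn

/-- `⟨p₀, p₁, …⟩ ↦ ⟨Φ p₀, Φ p₁, …⟩`. -/
def mapRows (Φ : Baire → Baire) (p : Baire) : Baire := fun m => Φ (row p m.unpair.1) m.unpair.2

theorem row_mapRows (Φ : Baire → Baire) (p : Baire) (i : ℕ) :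
    row (mapRows Φ p) i = Φ (row p i) := by
  funext j
  simp [row, mapRows]

theorem BoundedUse.mapRows {Φ : Baire → Baire} (hΦ : BoundedUse Φ) : BoundedUse (mapRows Φ) := by
  have h : Computable fun x : ℕ × ℕ => Nat.pair x.1.unpair.1 x.2 :=
    computable_pair.comp (computable_unpair_fst.comp Computable.fst) Computable.snd
  exact hΦ.subst (BoundedUse.apply h) computable_unpair_snd

theorem BoundedUse.mapRows_iterate {Φ : Baire → Baire} (hΦ : BoundedUse Φ) (n : ℕ) :
    BoundedUse (Weihrauch.mapRows^[n] Φ) := by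
  induction n with
  | zero => exact hΦ
  | succ n ih =>
    rw [Function.iterate_succ_apply']
    exact ih.mapRows

/-- `p ↦ ⟨p, p, …⟩`. -/
def constRows (p : Baire) : Baire := fun m => p m.unpair.2

theorem row_constRows (p : Baire) (i : ℕ) : row (constRows p) i = p := by
  funext j
  simp [row, constRows]

theorem BoundedUse.constRows : BoundedUse constRows := BoundedUse.apply computable_unpair_snd

/-- `q` is obtained from `p` by `n` times passing from `⟨p₀, p₁, …⟩` to `lim pᵢ`, all these limits
being required to exist. -/
def IterLim : ℕ → Baire → Baire → Prop
  | 0, p, q => p = q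
  | n + 1, p, q => ∃ r, Tendsto (row p) atTop (𝓝 r) ∧ IterLim n r q

/-- `⟨⟨p₀, p₁, …⟩, r⟩ ↦ ⟨⟨p₀, r⟩, ⟨p₁, r⟩, …⟩`. -/
def joinRows (u : Baire) : Baire := fun m =>
  join (row (evenPart u) m.unpair.1) (oddPart u) m.unpair.2

theorem row_joinRows (p r : Baire) (i : ℕ) : row (joinRows (join p r)) i = join (row p i) r := by
  funext j
  simp [row, joinRows, evenPart_join, oddPart_join]

theorem BoundedUse.joinRows : BoundedUse joinRows := by
  have h2 := computable_unpair_snd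
  have half := computable_div_two.comp h2
  exact BoundedUse.ite_eq
    (BoundedUse.of_computable (computable_mod_two.comp h2))
    (BoundedUse.const 0)
    (BoundedUse.apply (computable_two_mul.comp
      (computable_pair.comp computable_unpair_fst half)))
    (BoundedUse.apply (computable_two_mul_add_one.comp half))

theorem tendsto_join {u : ℕ → Baire} {q : Baire} (h : Tendsto u atTop (𝓝 q)) (r : Baire) :
    Tendsto (fun n => join (u n) r) atTop (𝓝 (join q r)) := by
  rw [tendsto_baire_iff] at h ⊢
  intro k
  filter_upwards [h (k / 2)] with n hn
  simp only [join, hn]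

namespace IterLim

theorem unique {n : ℕ} {p q q' : Baire} (h : IterLim n p q) (h' : IterLim n p q') : q = q' := by
  induction n generalizing p with
  | zero => exact h.symm.trans h'
  | succ n ih =>
    obtain ⟨r, hr, h⟩ := h
    obtain ⟨r', hr', h'⟩ := h'
    obtain rfl := tendsto_nhds_unique hr hr'
    exact ih h h'

theorem trans {m n : ℕ} {p q r : Baire} (h : IterLim m p q) (h' : IterLim n q r) :
    IterLim (m + n) p r := by
  induction m generalizing p with
  | zero =>
    obtain rfl : p = q := h
    rwa [Nat.zero_add]
  | succ m ih =>
    obtain ⟨s, hs, h⟩ := h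
    rw [Nat.succ_add]
    exact ⟨s, hs, ih h⟩

theorem one_iff {p q : Baire} : IterLim 1 p q ↔ Tendsto (row p) atTop (𝓝 q) :=
  ⟨by rintro ⟨_, h, rfl⟩; exact h, fun h => ⟨q, h, rfl⟩⟩

/-- A continuous functional commutes with limits, so it can be pulled inside an iterated limit. -/
theorem mapRows {n : ℕ} {p q : Baire} (h : IterLim n p q) {Φ : Baire → Baire}
    (hΦ : BoundedUse Φ) : IterLim n ((Weihrauch.mapRows^[n] Φ) p) (Φ q) := by
  induction n generalizing p with
  | zero => exact congrArg Φ h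
  | succ n ih =>
    obtain ⟨r, hr, h⟩ := h
    refine ⟨_, ?_, ih h⟩
    rw [Function.iterate_succ_apply']
    refine ((hΦ.mapRows_iterate n).tendsto hr).congr fun i => ?_
    rw [row_mapRows]

/-- A parameter can be carried through an iterated limit. -/
theorem exists_join (n : ℕ) : ∃ J : Baire → Baire, BoundedUse J ∧
    ∀ p q r, IterLim n p q → IterLim n (J (join p r)) (join q r) := by
  induction n with
  | zero => exact ⟨fun p => p, BoundedUse.id, fun p q r h => congrArg (join · r) h⟩
  | succ n ih =>
    obtain ⟨J, hJ, h⟩ := ih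
    refine ⟨fun u => Weihrauch.mapRows J (joinRows u), hJ.mapRows.comp BoundedUse.joinRows, ?_⟩
    rintro p q r ⟨s, hs, hq⟩
    refine ⟨J (join s r), ?_, h s q r hq⟩
    refine (hJ.tendsto (tendsto_join hs r)).congr fun i => ?_
    rw [row_mapRows, row_joinRows]

end IterLim

/-! ### Limit computable functionals -/

/-- A total functional is limit computable if, for some fixed `n`, its values are `n`-fold iterated
limits of a functional with bounded use. The iterated limit has to exist at every oracle. -/
def LimComputable (G : Baire → Baire) : Prop :=
  ∃ (n : ℕ) (Φ : Baire → Baire), BoundedUse Φ ∧ ∀ p, IterLim n (Φ p) (G p)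

theorem BoundedUse.limComputable {Φ : Baire → Baire} (h : BoundedUse Φ) : LimComputable Φ :=
  ⟨0, Φ, h, fun _ => rfl⟩

namespace LimComputable

protected theorem comp {G H : Baire → Baire} (hG : LimComputable G) (hH : LimComputable H) :
    LimComputable fun p => G (H p) := by
  obtain ⟨n, Φ, hΦ, hG⟩ := hG
  obtain ⟨m, Ψ, hΨ, hH⟩ := hH
  exact ⟨m + n, fun p => (mapRows^[m] Φ) (Ψ p), (hΦ.mapRows_iterate m).comp hΨ,
    fun p => ((hH p).mapRows hΦ).trans (hG _)⟩

theorem join_left {G : Baire → Baire} (hG : LimComputable G) :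
    LimComputable fun u => join (G (evenPart u)) (oddPart u) := by
  obtain ⟨n, Φ, hΦ, hG⟩ := hG
  obtain ⟨J, hJ, h⟩ := IterLim.exists_join n
  exact ⟨n, fun u => J (join (Φ (evenPart u)) (oddPart u)),
    hJ.comp ((hΦ.comp BoundedUse.id.even).join BoundedUse.id.odd), fun u => h _ _ _ (hG _)⟩

protected theorem join {G H : Baire → Baire} (hG : LimComputable G) (hH : LimComputable H) :
    LimComputable fun p => join (G p) (H p) := by
  have h1 : LimComputable fun p => join (H p) p := by
    have := hH.join_left.comp (BoundedUse.id.join BoundedUse.id).limComputable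
    simpa only [evenPart_join, oddPart_join] using this
  have h2 := hG.join_left.comp
    ((BoundedUse.id.odd.join BoundedUse.id.even).limComputable.comp h1)
  simpa only [evenPart_join, oddPart_join] using h2

theorem even {G : Baire → Baire} (hG : LimComputable G) : LimComputable fun p => evenPart (G p) :=
  BoundedUse.id.even.limComputable.comp hG

theorem odd {G : Baire → Baire} (hG : LimComputable G) : LimComputable fun p => oddPart (G p) :=
  BoundedUse.id.odd.limComputable.comp hG

/-- Pointwise limits of limit computable functionals are limit computable. -/
theorem of_tendsto {G H : Baire → Baire} (hG : LimComputable G)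
    (h : ∀ p, Tendsto (row (G p)) atTop (𝓝 (H p))) : LimComputable H := by
  obtain ⟨n, Φ, hΦ, hG⟩ := hG
  exact ⟨n + 1, Φ, hΦ, fun p => (hG p).trans (IterLim.one_iff.2 (h p))⟩

end LimComputable

open Classical in
/-- Universal number quantification: `allZero p n` is the truth value of `∀ k, p ⟨n, k⟩ = 0`. -/
noncomputable def allZero (p : Baire) : Baire :=
  fun n => if ∀ k, p (Nat.pair n k) = 0 then 1 else 0

theorem allZero_apply_eq_one {p : Baire} {n : ℕ} :
    allZero p n = 1 ↔ ∀ k, p (Nat.pair n k) = 0 := by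
  simp [allZero]

theorem LimComputable.allZero : LimComputable allZero := by
  -- at stage `s`, only the `k < s` are examined
  let Φ : Baire → Baire := fun p m =>
    if prefixOf (fun k => p (Nat.pair m.unpair.2 k)) m.unpair.1 = prefixOf (fun _ => 0) m.unpair.1
    then 1 else 0
  have hΦ : BoundedUse Φ := by
    refine BoundedUse.ite_eq ?_ ?_ (BoundedUse.const 1)
      (BoundedUse.const 0)
    · exact BoundedUse.prefixOf (F := fun p x => p (Nat.pair x.1.unpair.2 x.2))
        (BoundedUse.apply (computable_pair.comp
          (computable_unpair_snd.comp Computable.fst) Computable.snd)) computable_unpair_fst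
    · exact BoundedUse.prefixOf (F := fun _ _ => 0)
        (BoundedUse.const 0) computable_unpair_fst
  refine hΦ.limComputable.of_tendsto fun p => tendsto_row_iff.2 fun n => ?_
  simp only [Φ, prefixOf_eq_iff, Nat.unpair_pair, Weihrauch.allZero]
  by_cases h : ∀ k, p (Nat.pair n k) = 0
  · exact ⟨0, fun s _ => by simp [h]⟩
  · simp only [if_neg h]
    push Not at h
    obtain ⟨k, hk⟩ := h
    exact ⟨k + 1, fun s hs => if_neg fun h => hk (h k hs)⟩

/-- The partial operation `⟨p₀, p₁, …⟩ ↦ lim pᵢ` has a total limit computable extension. Its value at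
`k` is the limit over `s` of `pₛ k` if `pᵢ k` is constant for `i ≥ s`, and of `0` otherwise; this
limit always exists, and the case distinction is made with `allZero`. -/
theorem exists_limComputable_lim :
    ∃ G, LimComputable G ∧ ∀ p q, Tendsto (row p) atTop (𝓝 q) → G p = q := by
  classical
  -- `C p ⟨⟨s, k⟩, i⟩ = 0` if the rows `s` and `s + i` of `p` agree at `k`
  let C : Baire → Baire := fun p m =>
    if p (Nat.pair (m.unpair.1.unpair.1 + m.unpair.2) m.unpair.1.unpair.2) = p m.unpair.1
    then 0 else 1
  let V : Baire → Baire := fun u m => if evenPart u m = 1 then oddPart u m else 0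
  have h1 := computable_unpair_fst
  have h2 := computable_unpair_snd
  have hC : BoundedUse C := BoundedUse.ite_eq
    (BoundedUse.apply (computable_pair.comp
      (Primrec.nat_add.to_comp.comp (h1.comp h1) h2) (h2.comp h1)))
    (BoundedUse.apply h1) (BoundedUse.const 0)
    (BoundedUse.const 1)
  have hV : BoundedUse V := BoundedUse.ite_eq BoundedUse.id.even
    (BoundedUse.const 1) BoundedUse.id.odd
    (BoundedUse.const 0)
  let S : Baire → Baire := fun p => V (join (allZero (C p)) p)
  have hSc : LimComputable S := hV.limComputable.comp
    ((LimComputable.allZero.comp hC.limComputable).join BoundedUse.id.limComputable)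
  have hS : ∀ p s k, S p (Nat.pair s k) =
      if ∀ i, p (Nat.pair (s + i) k) = p (Nat.pair s k) then p (Nat.pair s k) else 0 := by
    intro p s k
    have e : allZero (C p) (Nat.pair s k) = 1 ↔
        ∀ i, p (Nat.pair (s + i) k) = p (Nat.pair s k) := by
      simp [allZero_apply_eq_one, C]
    simp only [S, V, evenPart_join, oddPart_join, e]
  have key : ∀ p k N, (∀ i, p (Nat.pair (N + i) k) = p (Nat.pair N k)) →
      ∀ n, N ≤ n → S p (Nat.pair n k) = p (Nat.pair N k) := by
    intro p k N hN n hn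
    obtain ⟨d, rfl⟩ := Nat.exists_eq_add_of_le hn
    rw [hS, if_pos fun i => by rw [Nat.add_assoc, hN, hN], hN]
  have hconv : ∀ p, ∃ q, Tendsto (row (S p)) atTop (𝓝 q) := by
    intro p
    refine exists_tendsto_row fun k => ?_
    by_cases h : ∃ N, ∀ i, p (Nat.pair (N + i) k) = p (Nat.pair N k)
    · obtain ⟨N, hN⟩ := h
      exact ⟨_, N, key p k N hN⟩
    · exact ⟨0, 0, fun n _ => by rw [hS, if_neg fun hn => h ⟨n, hn⟩]⟩
  choose L hL using hconv
  refine ⟨L, hSc.of_tendsto hL, fun p q hq => tendsto_nhds_unique (hL p) ?_⟩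
  rw [tendsto_row_iff] at hq ⊢
  intro k
  obtain ⟨N, hN⟩ := hq k
  refine ⟨N, fun n hn => ?_⟩
  rw [key p k N (fun i => by rw [hN _ (Nat.le_add_right N i), hN N le_rfl]) n hn, hN N le_rfl]

theorem exists_limComputable_iterLim (n : ℕ) :
    ∃ G, LimComputable G ∧ ∀ p q, IterLim n p q → G p = q := by
  induction n with
  | zero => exact ⟨fun p => p, BoundedUse.id.limComputable, fun p q h => h⟩
  | succ n ih =>
    obtain ⟨G, hG, h⟩ := ih
    obtain ⟨L, hL, hlim⟩ := exists_limComputable_lim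
    refine ⟨fun p => G (L p), hG.comp hL, ?_⟩
    rintro p q ⟨r, hr, hq⟩
    exact (congrArg G (hlim p r hr)).trans (h r q hq)

/-- A partial computable functional has a total limit computable extension: the `k`-th value is the
limit over `s` of the `k`-th symbol written after reading `s` symbols of the input, with `0` for
symbols not yet written. -/
theorem IsComputable.exists_limComputable {F : Baire →. Baire} (hF : IsComputable F) :
    ∃ G, LimComputable G ∧ ∀ p, ∀ q ∈ F p, G p = q := by
  obtain ⟨h, hc, hmono, hF⟩ := hF
  let Φ : Baire → Baire := fun p m => (h (prefixOf p m.unpair.1)).getD m.unpair.2 0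
  have hΦ : BoundedUse Φ := by
    have hp : BoundedUse fun p (m : ℕ) => prefixOf p m.unpair.1 :=
      BoundedUse.prefixOf (F := fun p (x : ℕ × ℕ) => p x.2) (BoundedUse.apply Computable.snd)
        computable_unpair_fst
    exact (hp.map hc).map₂ (BoundedUse.of_computable computable_unpair_snd)
      (f := fun l i => l.getD i 0) (Primrec.list_getD 0).to_comp
  have stable : ∀ {σ τ : List ℕ} {k : ℕ}, σ <+: τ → k < σ.length → τ.getD k 0 = σ.getD k 0 := by
    rintro σ _ k ⟨ρ, rfl⟩ hk
    exact List.getD_append _ _ _ _ hk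
  have hconv : ∀ p, ∃ q, Tendsto (row (Φ p)) atTop (𝓝 q) := by
    intro p
    refine exists_tendsto_row fun k => ?_
    simp only [Φ, Nat.unpair_pair]
    by_cases hk : ∃ N, k < (h (prefixOf p N)).length
    · obtain ⟨N, hN⟩ := hk
      exact ⟨_, N, fun n hn => stable (hmono _ _ (prefixOf_isPrefix p hn)) hN⟩
    · push Not at hk
      exact ⟨0, 0, fun n _ => List.getD_eq_default _ _ (hk n)⟩
  choose G hG using hconv
  refine ⟨G, hΦ.limComputable.of_tendsto hG, fun p q hq => tendsto_nhds_unique (hG p) ?_⟩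
  simp only [tendsto_row_iff, Φ, Nat.unpair_pair]
  intro k
  obtain ⟨N, hN⟩ := hF p q hq (k + 1)
  refine ⟨N, fun n hn => ?_⟩
  rw [stable (hN.trans (hmono _ _ (prefixOf_isPrefix p hn)))
    (by rw [length_prefixOf]; exact k.lt_succ_self), getD_prefixOf q k.lt_succ_self]

/-! ### Closed witnesses and trees -/

/-- The graph of the `n`-fold iterated limit is the projection of a closed set, given by a
functional with bounded use: the witness for `IterLim n r q` consists of the intermediate limits
together with moduli of convergence. -/
theorem exists_iterLim_witness (n : ℕ) : ∃ D : Baire → Baire, BoundedUse D ∧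
    (∀ r y, D (join r y) = 0 → IterLim n r (evenPart y)) ∧
    ∀ r q, IterLim n r q → ∃ w, D (join r (join q w)) = 0 := by
  have hid := BoundedUse.id
  induction n with
  | zero =>
    refine ⟨fun u k => if evenPart u k = evenPart (oddPart u) k then 0 else 1,
      BoundedUse.ite_eq hid.even hid.odd.even (BoundedUse.const 0)
        (BoundedUse.const 1), fun r y h => funext fun k => ?_, ?_⟩
    · have := congrFun h k
      simpa [evenPart_join, oddPart_join] using this
    · rintro r _ rfl
      refine ⟨0, funext fun k => ?_⟩
      simp [evenPart_join, oddPart_join]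
  | succ n ih =>
    obtain ⟨D, hD, hs, hw⟩ := ih
    -- `M ⟨r, ⟨r', m⟩⟩ = 0` says that `m` is a modulus for the convergence of the rows of `r`
    -- to `r'`; the truncated difference vanishes iff the first argument is at most the second
    let M : Baire → Baire := fun u k =>
      if oddPart (oddPart u) k.unpair.2 - k.unpair.1 = 0 then
        if evenPart u k = evenPart (oddPart u) k.unpair.2 then 0 else 1
      else 0
    have hM : BoundedUse M := by
      have h1 := computable_unpair_fst
      have h2 := computable_unpair_snd
      refine BoundedUse.ite_eq ?_ (BoundedUse.const 0)
        (BoundedUse.ite_eq hid.even (hid.odd.even.reindex h2)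
        (BoundedUse.const 0) (BoundedUse.const 1)) (BoundedUse.const 0)
      exact BoundedUse.map₂ (hid.odd.odd.reindex h2) (BoundedUse.of_computable h1)
        (f := fun a b => a - b) Primrec.nat_sub.to_comp
    have hM0 : ∀ r r' m, M (join r (join r' m)) = 0 ↔
        ∀ k s, m k ≤ s → r (Nat.pair s k) = r' k := by
      intro r r' m
      rw [funext_iff]
      simp only [M, evenPart_join, oddPart_join, Pi.zero_apply, Nat.sub_eq_zero_iff_le]
      constructor
      · intro h k s hm
        have := h (Nat.pair s k)
        simpa [hm] using this
      · intro h k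
        split_ifs with h1 h2
        · rfl
        · exact absurd (by simpa using h _ _ h1) h2
        · rfl
    -- the witness for `q` is `⟨r', ⟨m, w⟩⟩`, where `w` is a witness for `IterLim n r' q`
    have hDc : BoundedUse fun u : Baire => join
        (M (join (evenPart u) (join (evenPart (oddPart (oddPart u)))
          (evenPart (oddPart (oddPart (oddPart u)))))))
        (D (join (evenPart (oddPart (oddPart u))) (join (evenPart (oddPart u))
          (oddPart (oddPart (oddPart (oddPart u))))))) :=
      (hM.comp (hid.even.join (hid.odd.odd.even.join hid.odd.odd.odd.even))).join
        (hD.comp (hid.odd.odd.even.join (hid.odd.even.join hid.odd.odd.odd.odd)))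
    refine ⟨_, hDc, fun r y h => ?_, fun r q h => ?_⟩
    · simp only [evenPart_join, oddPart_join, join_eq_zero, hM0] at h
      refine ⟨_, tendsto_row_iff.2 fun k => ⟨_, h.1 k⟩, ?_⟩
      simpa only [evenPart_join] using hs _ _ h.2
    · obtain ⟨r', hr, hq⟩ := h
      choose m hm using tendsto_row_iff.1 hr
      obtain ⟨w, hw⟩ := hw r' q hq
      refine ⟨join r' (join m w), ?_⟩
      simp only [evenPart_join, oddPart_join, join_eq_zero, hM0]
      exact ⟨hm, hw⟩

theorem isClosed_paths (T : Set (List ℕ)) : IsClosed (paths T) := by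
  refine IsSeqClosed.isClosed fun u p hu hp n => ?_
  obtain ⟨i, hi⟩ := (eventually_prefixOf_eq hp n).exists
  exact hi ▸ hu i n

/-- The list with code `e`, with `[]` for numbers `e` that are not codes. -/
def decodeList (e : ℕ) : List ℕ := (Encodable.decode (α := List ℕ) e).getD []

theorem decodeList_encode (σ : List ℕ) : decodeList (Encodable.encode σ) = σ := by
  simp [decodeList]

theorem computable_decodeList : Computable decodeList :=
  Computable.option_getD Computable.decode (Computable.const [])

/-- `pathTest ⟨z, x⟩ = 0` says that `x` is a path through the tree with characteristic function `z`.
The queries to `z` must not depend on `x`; so all lists `σ` are tested, those that are not prefixes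
of `x` trivially, instead of looking up the prefixes of `x` in `z`. -/
def pathTest (u : Baire) : Baire := fun e =>
  if prefixOf (oddPart u) (decodeList e).length = decodeList e then
    if evenPart u (Encodable.encode (decodeList e)) = 1 then 0 else 1
  else 0

theorem BoundedUse.pathTest : BoundedUse pathTest := by
  refine BoundedUse.ite_eq ?_ (BoundedUse.of_computable computable_decodeList)
    (BoundedUse.ite_eq (BoundedUse.id.even.reindex
      (Computable.encode.comp computable_decodeList)) (BoundedUse.const 1)
      (BoundedUse.const 0) (BoundedUse.const 1)) (BoundedUse.const 0)
  exact BoundedUse.prefixOf (F := fun p (x : ℕ × ℕ) => oddPart p x.2)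
    (BoundedUse.id.odd.reindex Computable.snd) (Computable.list_length.comp computable_decodeList)

theorem pathTest_eq_zero {z x : Baire} {T : Set (List ℕ)} (hz : IsCharFun z T) :
    pathTest (join z x) = 0 ↔ x ∈ paths T := by
  have hz1 : ∀ σ, z (Encodable.encode σ) = 1 ↔ σ ∈ T := fun σ => by
    rcases hz σ with h | h <;> simp [h]
  rw [funext_iff]
  simp only [pathTest, evenPart_join, oddPart_join, Pi.zero_apply, hz1]
  constructor
  · intro h n
    simpa [decodeList_encode, length_prefixOf, evenPart_join, hz1] using
      h (Encodable.encode (prefixOf x n))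
  · intro h e
    split_ifs with h1 h2
    · rfl
    · rw [evenPart_join, hz1, ← h1] at h2
      exact absurd (h _) h2
    · rfl

open Classical in
/-- The sections of a closed set `{⟨p, x⟩ | D ⟨p, x⟩ = 0}` have names computable from `p`. With `b` a
bound for the use of `D`, a list `σ` belongs to the tree if `D ⟨p, x⟩ k = 0` for all `k < |σ|` such
that `b k ≤ |σ|`, where `x` is any extension of `σ`. -/
theorem exists_tree_of_boundedUse {D : Baire → Baire} (hD : BoundedUse D) :
    ∃ Φ : Baire → Baire, BoundedUse Φ ∧ ∀ p, ∃ T, IsTree T ∧ IsCharFun (Φ p) T ∧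
      paths T = {x | D (join p x) = 0} := by
  obtain ⟨b, hb, hbD⟩ := hD.exists_eq_of_prefixOf_eq
  -- the extension by zeros
  let ext : List ℕ → Baire := fun σ i => σ.getD i 0
  -- the truncated difference vanishes iff the use at `k` is at most the length of the list
  let Q : Baire → ℕ × ℕ → ℕ := fun p x =>
    if b x.2 - (decodeList x.1).length = 0 then D (join p (ext (decodeList x.1))) x.2 else 0
  let Φ : Baire → Baire := fun p e =>
    if prefixOf (fun k => Q p (e, k)) (decodeList e).length =
      prefixOf (fun _ => 0) (decodeList e).length
    then 1 else 0
  have hQ : BoundedUse Q := by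
    refine BoundedUse.ite_eq (BoundedUse.of_computable ?_) (BoundedUse.const 0) ?_ (BoundedUse.const 0)
    · exact Primrec.nat_sub.to_comp.comp (hb.comp Computable.snd)
        (Computable.list_length.comp (computable_decodeList.comp Computable.fst))
    · refine hD.subst (Θ := fun p (y : (ℕ × ℕ) × ℕ) => join p (ext (decodeList y.1.1)) y.2) ?_
        Computable.snd
      have half : Computable fun y : (ℕ × ℕ) × ℕ => y.2 / 2 :=
        computable_div_two.comp Computable.snd
      refine BoundedUse.ite_eq (BoundedUse.of_computable
        (computable_mod_two.comp Computable.snd))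
        (BoundedUse.const 0) (BoundedUse.apply half)
        (BoundedUse.of_computable ?_)
      exact (Primrec.list_getD 0).to_comp.comp
        (computable_decodeList.comp (Computable.fst.comp Computable.fst)) half
  have hΦ : BoundedUse Φ := by
    refine BoundedUse.ite_eq (hQ.prefixOf (Computable.list_length.comp computable_decodeList)) ?_
      (BoundedUse.const 1)
      (BoundedUse.const 0)
    exact (BoundedUse.const 0).prefixOf (Computable.list_length.comp computable_decodeList)
  let T : Baire → Set (List ℕ) := fun p =>
    {σ | ∀ k < σ.length, b k ≤ σ.length → D (join p (ext σ)) k = 0}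
  have hloc : ∀ p x σ k, prefixOf x σ.length = σ → b k ≤ σ.length →
      D (join p (ext σ)) k = D (join p x) k := by
    intro p x σ k hx hk
    refine hbD _ _ _ (prefixOf_eq_iff.2 fun i hi => ?_)
    have h2 := prefixOf_eq_iff.1 ((prefixOf_getD σ).trans hx.symm) (i / 2) (by omega)
    simp only [join, ext, h2]
  refine ⟨Φ, hΦ, fun p => ⟨T p, fun σ τ hστ hτ k hk hbk => ?_, fun σ => ?_, ?_⟩⟩
  · rw [hloc p (ext τ) σ k (prefixOf_getD_of_isPrefix hστ) hbk]
    exact hτ k (hk.trans_le hστ.length_le) (hbk.trans hστ.length_le)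
  · have : Φ p (Encodable.encode σ) = if σ ∈ T p then 1 else 0 := by
      simp only [Φ, Q, decodeList_encode, prefixOf_eq_iff, T, Set.mem_ofPred_eq,
        Nat.sub_eq_zero_iff_le]
      congr 1
      simp only [ite_eq_right_iff]
    by_cases h : σ ∈ T p
    · exact Or.inl ⟨h, by rw [this, if_pos h]⟩
    · exact Or.inr ⟨h, by rw [this, if_neg h]⟩
  · ext x
    constructor
    · intro h
      funext k
      have := h (max (b k) (k + 1)) k (by rw [length_prefixOf]; omega)
        (by rw [length_prefixOf]; omega)
      rwa [hloc p x _ k (by rw [length_prefixOf]) (by rw [length_prefixOf]; omega)] at this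
    · intro h n k _ hk
      rw [hloc p x _ k (by rw [length_prefixOf]) hk]
      exact congrFun h k

variable {X Y Z W : Type*}

/-! ### Weihrauch reductions pointwise -/

/-- A pair `(Φ, Ψ)` is a reduction iff at every name it works against every single correct answer
of the oracle. -/
theorem forall_realizes_reduct_iff {f : MultiFun X Y} {g : MultiFun Z W} {Φ Ψ : Baire →. Baire} :
    (∀ G, Realizes G g → Realizes (reduct Φ Ψ G) f) ↔
      ∀ p x, f.domRep.IsName p x → (f.val x).Nonempty →
        ∃ r ∈ Φ p, ∃ z, g.domRep.IsName r z ∧ (g.val z).Nonempty ∧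
          ∀ w ∈ g.val z, ∀ s, g.codRep.IsName s w →
            ∃ q ∈ Ψ (join p s), ∃ y ∈ f.val x, f.codRep.IsName q y := by
  classical
  constructor
  · intro h p x hp hx
    -- `G v` answers `v` whenever that is correct, and is defined only at names of points of the
    -- domain of `g`; so it also shows that `Φ p` is such a name
    let S : Baire → Set Baire := fun r =>
      {s | ∃ z, g.domRep.IsName r z ∧ ∃ w ∈ g.val z, g.codRep.IsName s w}
    let G : Baire → Baire →. Baire := fun v r =>
      ⟨(S r).Nonempty, fun hr => if v ∈ S r then v else hr.some⟩
    have hmem : ∀ v r s, s ∈ G v r → s ∈ S r := by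
      rintro v r s ⟨hr, rfl⟩
      change (if v ∈ S r then v else _) ∈ S r
      split_ifs with hv
      exacts [hv, hr.some_mem]
    have hG : ∀ v, Realizes (G v) g := by
      rintro v r z hr ⟨w, hw⟩
      obtain ⟨s, hs⟩ := g.codRep.surj w
      have hne : (S r).Nonempty := ⟨s, z, hr, w, hw, hs⟩
      obtain ⟨z', hz', w', hw', hs'⟩ := hmem v r ((G v r).get hne) (Part.get_mem hne)
      obtain rfl := g.domRep.unique hr hz'
      exact ⟨_, Part.get_mem hne, w', hw', hs'⟩
    have hred : ∀ v, ∃ r ∈ Φ p, ∃ s ∈ G v r, ∃ q ∈ Ψ (join p s),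
        ∃ y ∈ f.val x, f.codRep.IsName q y := by
      intro v
      obtain ⟨q, hq, hy⟩ := h (G v) (hG v) p x hp hx
      obtain ⟨r, hr, hq⟩ := Part.mem_bind_iff.1 hq
      obtain ⟨s, hs, hq⟩ := Part.mem_bind_iff.1 hq
      exact ⟨r, hr, s, hs, q, hq, hy⟩
    obtain ⟨r, hr, s, hs, -⟩ := hred p
    obtain ⟨z, hz, w, hw, -⟩ := hmem _ _ _ hs
    refine ⟨r, hr, z, hz, ⟨w, hw⟩, fun w' hw' v hv => ?_⟩
    obtain ⟨r', hr', s', hs', hq⟩ := hred v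
    obtain rfl := Part.mem_unique hr hr'
    have hvS : v ∈ S r := ⟨z, hz, w', hw', hv⟩
    obtain ⟨_, rfl⟩ := hs'
    simpa only [G, if_pos hvS] using hq
  · intro h G hG p x hp hx
    obtain ⟨r, hr, z, hz, hne, hs⟩ := h p x hp hx
    obtain ⟨s, hsG, w, hw, hsw⟩ := hG r z hz hne
    obtain ⟨q, hq, hy⟩ := hs w hw s hsw
    exact ⟨q, Part.mem_bind_iff.2 ⟨r, hr, Part.mem_bind_iff.2 ⟨s, hsG, hq⟩⟩, hy⟩

/-! ### Arithmetic functionals -/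

theorem limJump_codRep (n : ℕ) : (MultiFun.limJump n).codRep = .baire := by
  induction n with
  | zero => rfl
  | succ n ih => exact ih

/-- `lim⁽ⁿ⁾` is the `(n + 1)`-fold iterated limit. -/
theorem iterLim_succ_iff_limJump {n : ℕ} {p q : Baire} :
    IterLim (n + 1) p q ↔
      ∃ u, (MultiFun.limJump n).domRep.IsName p u ∧ q ∈ (MultiFun.limJump n).val u := by
  induction n generalizing p with
  | zero =>
    rw [IterLim.one_iff]
    constructor
    · intro h
      exact ⟨row p, fun i => rfl, h⟩
    · rintro ⟨u, hu, h⟩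
      have : row p = u := funext hu
      rw [this]
      exact h
  | succ n ih =>
    constructor
    · rintro ⟨r, hr, h⟩
      obtain ⟨u, hu, hq⟩ := ih.1 h
      exact ⟨u, ⟨r, hr, hu⟩, hq⟩
    · rintro ⟨u, ⟨r, hr, hu⟩, hq⟩
      exact ⟨r, hr, ih.2 ⟨u, hu, hq⟩⟩

/-- The number of limits can be taken to be positive, as required for `lim⁽ⁿ⁾`. -/
theorem LimComputable.exists_succ {G : Baire → Baire} (hG : LimComputable G) :
    ∃ (n : ℕ) (Φ : Baire → Baire), BoundedUse Φ ∧ ∀ p, IterLim (n + 1) (Φ p) (G p) := by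
  obtain ⟨n, Φ, hΦ, h⟩ := hG
  refine ⟨n, fun p => constRows (Φ p), BoundedUse.constRows.comp hΦ, fun p => ⟨Φ p, ?_, h p⟩⟩
  simp only [funext (row_constRows (Φ p))]
  exact tendsto_const_nhds

theorem LimComputable.isArithmetic {G : Baire → Baire} (hG : LimComputable G) :
    IsArithmetic fun p => Part.some (G p) := by
  obtain ⟨n, Φ, hΦ, h⟩ := hG.exists_succ
  refine ⟨n, _, _, hΦ.isComputable, BoundedUse.id.odd.isComputable,
    forall_realizes_reduct_iff.2 ?_⟩
  rintro p _ rfl -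
  obtain ⟨u, hu, hq⟩ := iterLim_succ_iff_limJump.1 (h p)
  refine ⟨_, Part.mem_some _, u, hu, ⟨_, hq⟩, fun w hw s hs => ?_⟩
  rw [limJump_codRep] at hs
  obtain rfl : s = w := hs
  obtain rfl := (h p).unique (iterLim_succ_iff_limJump.2 ⟨u, hu, hw⟩)
  exact ⟨_, Part.mem_some _, _, Part.mem_some _, oddPart_join _ _⟩

theorem IsArithmetic.exists_limComputable {F : Baire →. Baire} (hF : IsArithmetic F) :
    ∃ G, LimComputable G ∧ ∀ p, ∀ q ∈ F p, G p = q := by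
  obtain ⟨n, Φ, Ψ, hΦ, hΨ, h⟩ := hF
  rw [forall_realizes_reduct_iff] at h
  obtain ⟨Φ', hΦ', hΦe⟩ := hΦ.exists_limComputable
  obtain ⟨Ψ', hΨ', hΨe⟩ := hΨ.exists_limComputable
  obtain ⟨L, hL, hLe⟩ := exists_limComputable_iterLim (n + 1)
  refine ⟨fun p => Ψ' (join p (L (Φ' p))),
    hΨ'.comp (BoundedUse.id.limComputable.join (hL.comp hΦ')), fun p q hq => ?_⟩
  obtain ⟨r, hr, u, hu, ⟨w, hw⟩, hs⟩ := h p p rfl ⟨q, hq⟩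
  obtain ⟨q', hq', y, hy, hqy⟩ := hs w hw w (by rw [limJump_codRep]; rfl)
  obtain rfl : q' = y := hqy
  obtain rfl := Part.mem_unique hq hy
  simp only [hΦe p r hr, hLe r w (iterLim_succ_iff_limJump.2 ⟨u, hu, hw⟩)]
  exact hΨe _ _ hq'

/-! ### The two reductions -/

/-- For limit computable `Φ` and `Ψ`, a name of the closed set of all `⟨x, ⟨⟨Φ p, Ψ ⟨p, x⟩⟩, w⟩⟩`, where
`x` is a path through the tree with characteristic function `Φ p` and `w` witnesses that the second
component has been computed correctly, can be computed from `p`. -/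
theorem exists_tree_of_limComputable {Φ Ψ : Baire → Baire} (hΦ : LimComputable Φ)
    (hΨ : LimComputable Ψ) :
    ∃ Γ : Baire → Baire, BoundedUse Γ ∧ ∀ p T, IsCharFun (Φ p) T →
      ∃ S, IsTree S ∧ IsCharFun (Γ p) S ∧ ((paths T).Nonempty → (paths S).Nonempty) ∧
        ∀ v ∈ paths S, evenPart v ∈ paths T ∧
          oddPart (evenPart (oddPart v)) = Ψ (join p (evenPart v)) := by
  have hid := BoundedUse.id
  obtain ⟨n, Θ, hΘ, hΘlim⟩ : LimComputable fun u => join (Φ (evenPart u)) (Ψ u) :=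
    (hΦ.comp hid.even.limComputable).join hΨ
  have hΘlim' : ∀ p x, IterLim n (Θ (join p x)) (join (Φ p) (Ψ (join p x))) := fun p x => by
    simpa only [evenPart_join] using hΘlim (join p x)
  obtain ⟨D, hD, hDs, hDw⟩ := exists_iterLim_witness n
  -- `E ⟨p, ⟨x, y⟩⟩ = 0` says that `y` is a witness for the value at `⟨p, x⟩`, and that `x` is a path
  -- through the tree given by the first component of this value
  let E : Baire → Baire := fun u =>
    join (D (join (Θ (join (evenPart u) (evenPart (oddPart u)))) (oddPart (oddPart u))))
      (pathTest (join (evenPart (evenPart (oddPart (oddPart u)))) (evenPart (oddPart u))))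
  have hE : BoundedUse E :=
    (hD.comp ((hΘ.comp (hid.even.join hid.odd.even)).join hid.odd.odd)).join
      (BoundedUse.pathTest.comp (hid.odd.odd.even.even.join hid.odd.even))
  have hE0 : ∀ p x y, E (join p (join x y)) = 0 ↔
      D (join (Θ (join p x)) y) = 0 ∧ pathTest (join (evenPart (evenPart y)) x) = 0 := by
    intro p x y
    simp only [E, join_eq_zero, evenPart_join, oddPart_join]
  obtain ⟨Γ, hΓ, hΓT⟩ := exists_tree_of_boundedUse hE
  refine ⟨Γ, hΓ, fun p T hT => ?_⟩
  obtain ⟨S, hS, hSΓ, hSE⟩ := hΓT p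
  refine ⟨S, hS, hSΓ, ?_, fun v hv => ?_⟩
  · rintro ⟨a, ha⟩
    obtain ⟨w, hw⟩ := hDw _ _ (hΘlim' p a)
    refine ⟨join a (join (join (Φ p) (Ψ (join p a))) w), ?_⟩
    rw [hSE]
    refine (hE0 _ _ _).2 ⟨hw, ?_⟩
    rwa [evenPart_join, evenPart_join, pathTest_eq_zero hT]
  · rw [hSE, ← join_evenPart_oddPart v] at hv
    obtain ⟨h1, h2⟩ := (hE0 _ _ _).1 hv
    have h3 := (hDs _ _ h1).unique (hΘlim' _ _)
    rw [h3, evenPart_join, pathTest_eq_zero hT] at h2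
    exact ⟨h2, by rw [h3, oddPart_join]⟩

/-- If `sTC` finds the closed set of witnesses empty, then so is the instance of `TC`; any answer of
`TC` is then correct, and `lim⁽ⁿ⁾` has computed the result for the answer `0`. -/
theorem weihrauchLE_of_arithWeihrauchLE_TC {f : MultiFun X Y}
    (h : ArithWeihrauchLE f MultiFun.TC) :
    ∃ n, WeihrauchLE f (MultiFun.sTC.prod (MultiFun.limJump n)) := by
  obtain ⟨Φ, Ψ, hΦ, hΨ, h⟩ := h
  rw [forall_realizes_reduct_iff] at h
  obtain ⟨Φ', hΦ', hΦe⟩ := hΦ.exists_limComputable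
  obtain ⟨Ψ', hΨ', hΨe⟩ := hΨ.exists_limComputable
  have hid := BoundedUse.id
  -- `lim⁽ⁿ⁾` computes the total functional `p ↦ Ψ' ⟨p, 0⟩`, so its instance is valid for every `p`
  obtain ⟨n, Λ, hΛ, hΛlim⟩ := LimComputable.exists_succ (hΨ'.comp
    (hid.join (BoundedUse.const 0)).limComputable)
  obtain ⟨Γ, hΓ, hΓT⟩ := exists_tree_of_limComputable hΦ' hΨ'
  have hout : BoundedUse fun t k =>
      if evenPart (evenPart (oddPart t)) 0 = 0 then oddPart (oddPart t) k
      else oddPart (evenPart (oddPart (oddPart (evenPart (oddPart t))))) k :=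
    BoundedUse.ite_eq (hid.odd.even.even.reindex (Computable.const 0))
      (BoundedUse.const 0) hid.odd.odd hid.odd.even.odd.odd.even.odd
  refine ⟨n, _, _, (hΓ.join hΛ).isComputable, hout.isComputable,
    forall_realizes_reduct_iff.2 fun p x hp hx => ?_⟩
  obtain ⟨r, hr, A, ⟨T, -, hTr, hTA⟩, -, hans⟩ := h p x hp hx
  obtain rfl := hΦe p r hr
  have hans' : ∀ a : Baire, ((A : Set Baire).Nonempty → a ∈ (A : Set Baire)) →
      ∃ y ∈ f.val x, f.codRep.IsName (Ψ' (join p a)) y := by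
    intro a ha
    obtain ⟨q, hq, hy⟩ := hans a ha a rfl
    rwa [hΨe _ q hq]
  obtain ⟨S, hS, hSΓ, hne, hsound⟩ := hΓT p T hTr
  rw [hTA] at hne hsound
  obtain ⟨u, hu, hu'⟩ := iterLim_succ_iff_limJump.1 (hΛlim p)
  refine ⟨_, Part.mem_some _, (⟨paths S, isClosed_paths S⟩, u), ⟨?_, ?_⟩, ?_, ?_⟩
  · rw [evenPart_join]
    exact ⟨S, hS, hSΓ, rfl⟩
  · rw [oddPart_join]
    exact hu
  · refine Set.Nonempty.prod ?_ ⟨_, hu'⟩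
    rcases (paths S).eq_empty_or_nonempty with h | ⟨v, hv⟩
    · exact ⟨(0, 0), fun _ => h, fun h => absurd h (zero_ne_one (α := Fin 2))⟩
    · exact ⟨(1, v), fun h => absurd h (one_ne_zero (α := Fin 2)), fun _ => hv⟩
  rintro ⟨⟨b, v⟩, l⟩ ⟨⟨hb0, hb1⟩, hl⟩ s ⟨⟨hsb, hsv⟩, hsl⟩
  refine ⟨_, Part.mem_some _, ?_⟩
  simp only [oddPart_join]
  rw [limJump_codRep] at hsl
  obtain rfl : oddPart s = l := hsl
  obtain rfl : oddPart (evenPart s) = v := hsv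
  replace hsb : evenPart (evenPart s) 0 = (b : ℕ) := hsb
  have hl' : oddPart s = Ψ' (join p fun _ => 0) :=
    (iterLim_succ_iff_limJump.2 ⟨u, hu, hl⟩).unique (hΛlim p)
  simp only [hsb]
  match b, hb0, hb1 with
  | 0, hb0, _ =>
    simp only [Fin.val_zero, if_true]
    change ∃ y ∈ f.val x, f.codRep.IsName (oddPart s) y
    rw [hl']
    refine hans' _ fun hA => absurd (hb0 rfl) (hne hA).ne_empty
  | 1, _, hb1 =>
    obtain ⟨hA, hval⟩ := hsound _ (hb1 rfl)
    simp only [Fin.val_one, one_ne_zero, if_false]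
    change ∃ y ∈ f.val x, f.codRep.IsName
      (oddPart (evenPart (oddPart (oddPart (evenPart s))))) y
    rw [hval]
    exact hans' _ fun _ => hA

/-- An answer `a` of `TC` becomes one of `sTC` by deciding arithmetically whether `a` belongs to the
closed set, and the answer of `lim⁽ⁿ⁾` is itself arithmetic in the input. -/
theorem arithWeihrauchLE_TC_of_weihrauchLE {f : MultiFun X Y} {n : ℕ}
    (h : WeihrauchLE f (MultiFun.sTC.prod (MultiFun.limJump n))) :
    ArithWeihrauchLE f MultiFun.TC := by
  obtain ⟨Φ, Ψ, hΦ, hΨ, h⟩ := h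
  rw [forall_realizes_reduct_iff] at h
  obtain ⟨Φ', hΦ', hΦe⟩ := hΦ.exists_limComputable
  obtain ⟨Ψ', hΨ', hΨe⟩ := hΨ.exists_limComputable
  obtain ⟨L, hL, hLe⟩ := exists_limComputable_iterLim (n + 1)
  have hid := BoundedUse.id
  -- `β ⟨z, x⟩ 0` is `1` if `x` is a path through the tree with characteristic function `z`
  let β : Baire → Baire := fun u => allZero (fun k => pathTest u k.unpair.2)
  have hβ : LimComputable β :=
    LimComputable.allZero.comp (BoundedUse.pathTest.reindex computable_unpair_snd).limComputable
  have hβ1 : ∀ u, β u 0 = 1 ↔ pathTest u = 0 := by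
    intro u
    simp only [β, allZero_apply_eq_one, Nat.unpair_pair, funext_iff, Pi.zero_apply]
  have hΦp := hΦ'.comp hid.even.limComputable
  have hΨ'' : LimComputable fun t => Ψ' (join (evenPart t) (join
      (join (β (join (evenPart (Φ' (evenPart t))) (oddPart t))) (oddPart t))
      (L (oddPart (Φ' (evenPart t)))))) :=
    hΨ'.comp (hid.even.limComputable.join
      (((hβ.comp (hΦp.even.join hid.odd.limComputable)).join hid.odd.limComputable).join
        (hL.comp hΦp.odd)))
  refine ⟨_, _, hΦ'.even.isArithmetic, hΨ''.isArithmetic,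
    forall_realizes_reduct_iff.2 fun p x hp hx => ?_⟩
  obtain ⟨r, hr, ⟨A, u⟩, ⟨hA, hu⟩, ⟨⟨_, l⟩, -, hl⟩, hans⟩ := h p x hp hx
  obtain rfl := hΦe p r hr
  obtain ⟨T, hT, hTr, hTA⟩ := hA
  refine ⟨_, Part.mem_some _, A, ⟨T, hT, hTr, hTA⟩, ?_, ?_⟩
  · rcases (A : Set Baire).eq_empty_or_nonempty with h | ⟨a, ha⟩
    · exact ⟨0, fun h' => absurd h h'.ne_empty⟩
    · exact ⟨a, fun _ => ha⟩
  rintro _ ha a rfl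
  refine ⟨_, Part.mem_some _, ?_⟩
  simp only [evenPart_join, oddPart_join]
  have hLl : L (oddPart (Φ' p)) = l :=
    hLe _ _ (iterLim_succ_iff_limJump.2 ⟨u, hu, hl⟩)
  have hβA : β (join (evenPart (Φ' p)) a) 0 = 1 ↔ a ∈ (A : Set Baire) := by
    rw [hβ1, pathTest_eq_zero hTr, hTA]
  have hβ0 : β (join (evenPart (Φ' p)) a) 0 = 0 ∨ β (join (evenPart (Φ' p)) a) 0 = 1 := by
    simp only [β, allZero]
    split_ifs <;> simp
  obtain ⟨b, hb, hb0, hb1⟩ : ∃ b : Fin 2, β (join (evenPart (Φ' p)) a) 0 = (b : ℕ) ∧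
      (b = 0 → (A : Set Baire) = ∅) ∧ (b = 1 → a ∈ (A : Set Baire)) := by
    rcases hβ0 with h0 | h1
    · refine ⟨0, h0, fun _ => Set.not_nonempty_iff_eq_empty.1 fun hne => ?_,
        fun h => absurd h zero_ne_one⟩
      exact zero_ne_one (h0.symm.trans (hβA.2 (ha hne)))
    · exact ⟨1, h1, fun h => absurd h one_ne_zero, fun _ => hβA.1 h1⟩
  obtain ⟨q, hq, hy⟩ := hans ((b, a), l) ⟨⟨hb0, hb1⟩, hl⟩
    (join (join (β (join (evenPart (Φ' p)) a)) a) l)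
    ⟨⟨by rw [evenPart_join, evenPart_join]; exact hb,
      by rw [evenPart_join, oddPart_join]; rfl⟩, by rw [oddPart_join, limJump_codRep]; rfl⟩
  rwa [hLl, hΨe _ q hq]

end Weihrauch

theorem mainTheorem10 {X Y : Type*} (f : Weihrauch.MultiFun X Y) :
    Weihrauch.ArithWeihrauchLE f Weihrauch.MultiFun.TC ↔
      ∃ n : ℕ, Weihrauch.WeihrauchLE f
        (Weihrauch.MultiFun.sTC.prod (Weihrauch.MultiFun.limJump n)) :=
  ⟨Weihrauch.weihrauchLE_of_arithWeihrauchLE_TC,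
    fun ⟨_, h⟩ => Weihrauch.arithWeihrauchLE_TC_of_weihrauchLE h⟩
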